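/- A Motzkin path of length $n$ is a lattice path in $\mathbb{Z}\times\mathbb{Z}$ with $n$ steps, each equal to $U=(1,1)$, $H=(1,0)$ or $D=(1,-1)$, that starts at the origin, ends on the $x$-axis and never goes below the $x$-axis. Let $\mathcal{M}_n$ be the set of Motzkin paths of length $n$, partially ordered by $\gamma_1\le\gamma_2$ if and only if $\gamma_1$ lies weakly below $\gamma_2$ (the $n$-th Motzkin lattice), and let $M_n=|\mathcal{M}_n|$ be the $n$-th Motzkin number. For a finite poset $P$ let $\ell(P)$ be the number of edges of its Hasse diagram (the number of pairs $(x,y)$ such that $y$ covers $x$) and let $i(P)=\ell(P)/|P|$ be its Hasse index. Let $\binom{n;\,3}{k}$ be the coefficient of $x^k$ in $(1+x+x^2)^n$, and put $T(x)=\sum_{n\ge0}\binom{n;\,3}{n}x^n$ and $M(x)=\sum_{n\ge0}M_nx^n$. **Theorem.** The edge generating series $\ell_{\mathcal M}(x)=\sum_{n\ge0}\ell(\mathcal{M}_n)x^n$ of the Motzkin lattices is $$\ell_{\mathcal M}(x)=\frac{(1+x)\left(1-2x-x^2-(1-x)\sqrt{1-2x-3x^2}\right)}{2x^2\sqrt{1-2x-3x^2}}=(1+x)\bigl(T(x)-M(x)\bigr),$$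 where $\sqrt{1-2x-3x^2}$ is the formal power series with constant term $1$ whose square is $1-2x-3x^2$. Moreover, $$\ell(\mathcal{M}_n)=\binom{n;\,3}{n}-M_n+\binom{n-1;\,3}{n-1}-M_{n-1}\qquad(n\ge1),$$ $$\ell(\mathcal{M}_n)=\binom{n;\,3}{n-2}+\binom{n-1;\,3}{n-3}\qquad(n\ge3),$$ $$\ell(\mathcal{M}_n)=\frac{2}{n}\sum_{k=0}^{\lfloor n/2\rfloor}\binom{n}{k}\binom{n-k}{k}\frac{k(n-k)}{k+1}\qquad(n\ge1).$$ As $n\to+\infty$, $$\ell(\mathcal{M}_n)\sim\frac{2\cdot3^n}{\sqrt{3n\pi}}\qquad\text{and}\qquad i(\mathcal{M}_n)=\frac{\ell(\mathcal{M}_n)}{|\mathcal{M}_n|}\sim\frac49\,n .$$ In particular, the Hasse index of the Motzkin lattices is asymptotically quasi Boolean, that is, there is a constant $c$ with $0\le c\le 1/10$ such that $i(\mathcal{M}_n)\sim(1/2+c)\,n$ or $i(\mathcal{M}_n)\sim(1/2-c)\,n$. -/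

import Mathlib

open Filter Asymptotics
open scoped PowerSeries LaurentSeries

/-- The steps `U = (1,1)`, `H = (1,0)`, `D = (1,-1)`. -/
inductive MotzkinStep : Type
  | U | H | D
  deriving DecidableEq

instance : Fintype MotzkinStep where
  elems := {.U, .H, .D}
  complete := fun a => by cases a <;> simp

/-- The vertical displacement of a step. -/
def MotzkinStep.rise : MotzkinStep → ℤ
  | .U => 1
  | .H => 0
  | .D => -1

/-- The ordinate reached after the first `i` steps of a path starting at the origin. -/
def pathHeight (w : List MotzkinStep) (i : ℕ) : ℤ :=
  ((w.take i).map MotzkinStep.rise).sum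

/-- Motzkin paths of length `n`: words of `n` steps, starting at the origin, ending on the
`x`-axis and never going below the `x`-axis. -/
@[ext]
structure MotzkinPath (n : ℕ) : Type where
  steps : List MotzkinStep
  length_eq : steps.length = n
  ends_on_axis : pathHeight steps n = 0
  nonneg : ∀ i, 0 ≤ pathHeight steps i

/-- A word of steps is determined by its length and its heights. -/
theorem eq_of_pathHeight_eq : ∀ {v w : List MotzkinStep}, v.length = w.length →
    (∀ i, pathHeight v i = pathHeight w i) → v = w
  | [], [], _, _ => rfl
  | [], _ :: _, h, _ => by simp at h
  | _ :: _, [], h, _ => by simp at h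
  | a :: v, b :: w, h, hh => by
    have h1 : a.rise = b.rise := by simpa [pathHeight] using hh 1
    have hab : a = b := by
      cases a <;> cases b <;> first | rfl | (simp [MotzkinStep.rise] at h1)
    subst hab
    congr 1
    refine eq_of_pathHeight_eq (by simpa using h) fun i => ?_
    simpa [pathHeight] using hh (i + 1)

/-- `γ₁ ≤ γ₂` when `γ₁` lies weakly below `γ₂`. -/
instance (n : ℕ) : PartialOrder (MotzkinPath n) where
  le γ₁ γ₂ := ∀ i, pathHeight γ₁.steps i ≤ pathHeight γ₂.steps i
  le_refl _ _ := le_rfl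
  le_trans _ _ _ h₁ h₂ i := (h₁ i).trans (h₂ i)
  le_antisymm γ₁ γ₂ h₁ h₂ := MotzkinPath.ext <|
    eq_of_pathHeight_eq (γ₁.length_eq.trans γ₂.length_eq.symm) fun i => le_antisymm (h₁ i) (h₂ i)

instance (n : ℕ) : Finite (MotzkinPath n) :=
  Finite.of_injective (β := List.Vector MotzkinStep n) (fun γ => ⟨γ.steps, γ.length_eq⟩)
    fun _ _ h => MotzkinPath.ext (congrArg Subtype.val h)

/-- `ℓ(P)`: the number of edges of the Hasse diagram of a finite poset, that is, the number of
pairs `(x, y)` such that `y` covers `x`. -/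
noncomputable def hasseEdges (P : Type*) [PartialOrder P] : ℕ :=
  Nat.card {p : P × P // p.1 ⋖ p.2}

/-- The Hasse index `i(P) = ℓ(P) / |P|`. -/
noncomputable def hasseIndex (P : Type*) [PartialOrder P] : ℝ :=
  (hasseEdges P : ℝ) / (Nat.card P : ℝ)

/-- The edge generating series of a sequence of posets. -/
noncomputable def edgeSeries (P : ℕ → Type*) [∀ n, PartialOrder (P n)] : ℚ⟦X⟧ :=
  PowerSeries.mk fun n => (hasseEdges (P n) : ℚ)

/-- The Hasse index of a sequence of posets is asymptotically quasi Boolean when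
`i(P n) ∼ (1/2 ± c) n` for some constant `0 ≤ c ≤ 1/10`. -/
def AsymptoticallyQuasiBoolean (P : ℕ → Type*) [∀ n, PartialOrder (P n)] : Prop :=
  ∃ c : ℝ, 0 ≤ c ∧ c ≤ 1 / 10 ∧
    (((fun n => hasseIndex (P n)) ~[atTop] fun n : ℕ => (1 / 2 + c) * (n : ℝ)) ∨
      ((fun n => hasseIndex (P n)) ~[atTop] fun n : ℕ => (1 / 2 - c) * (n : ℝ)))

/-- The trinomial coefficient: the coefficient of `x ^ k` in `(1 + x + x ^ 2) ^ n`. -/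
noncomputable def trinomialCoeff (n k : ℕ) : ℕ :=
  ((1 + Polynomial.X + Polynomial.X ^ 2 : Polynomial ℕ) ^ n).coeff k

/-- The Motzkin number `M_n`, the number of Motzkin paths of length `n`. -/
noncomputable def motzkinNumber (n : ℕ) : ℕ := Nat.card (MotzkinPath n)

/-- `T(x)`, the generating series of the central trinomial coefficients. -/
noncomputable def centralTrinomialSeries : ℚ⟦X⟧ :=
  PowerSeries.mk fun n => (trinomialCoeff n n : ℚ)

/-- `M(x)`, the generating series of the Motzkin numbers. -/
noncomputable def motzkinSeries : ℚ⟦X⟧ :=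
  PowerSeries.mk fun n => (motzkinNumber n : ℚ)

/-!
A Motzkin path is covered by the paths obtained by raising one of its weak valleys, the interior
points neither of whose neighbours lies lower, so `ℓ(𝓜ₙ)` is the total number of weak valleys of
Motzkin paths. A weak valley is a pair of consecutive steps; contracting it to one step gives a
shorter path with a marked step, whence `ℓ(𝓜ₙ₊₂) + Mₙ₊₂ = (n + 2) Mₙ₊₁ + (n + 1) Mₙ`.

Let `W(n, j)` be the number of walks of `n` steps `-1`, `0`, `1` with displacement `j`, which is a
trinomial coefficient. The reflection principle gives `Mₙ = W(n, 0) - W(n, 2)`, and differentiating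
`(x⁻¹ + 1 + x) ^ (n + 1)` gives `(n + 1) Mₙ = W(n + 1, 1)`. The recurrence then collapses to
`ℓ(𝓜ₙ₊₁) = W(n + 1, 2) + W(n, 2)`, which contains all the closed forms. For the generating series,
the square root comes from the quadratic equation `M = 1 + x M + x² M²`. For the asymptotics,
`W(n, j) / 3ⁿ` is a Fourier coefficient of the `n`-th power of the characteristic function of a
uniform step, and dominated convergence after rescaling by `√n` reduces it to a Gaussian integral.
-/

/-! ### Paths and their heights -/

section Heights

@[simp] lemma pathHeight_zero (w : List MotzkinStep) : pathHeight w 0 = 0 := by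
  simp [pathHeight]

@[simp] lemma pathHeight_nil (i : ℕ) : pathHeight [] i = 0 := by
  simp [pathHeight]

@[simp] lemma pathHeight_cons_succ (s : MotzkinStep) (w : List MotzkinStep) (i : ℕ) :
    pathHeight (s :: w) (i + 1) = s.rise + pathHeight w i := by
  simp [pathHeight]

lemma pathHeight_of_length_le {w : List MotzkinStep} {i : ℕ} (h : w.length ≤ i) :
    pathHeight w i = pathHeight w w.length := by
  simp [pathHeight, List.take_of_length_le h]

@[simp] lemma MotzkinStep.rise_U : MotzkinStep.U.rise = 1 := rfl

@[simp] lemma MotzkinStep.rise_H : MotzkinStep.H.rise = 0 := rfl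

@[simp] lemma MotzkinStep.rise_D : MotzkinStep.D.rise = -1 := rfl

lemma MotzkinStep.exists_rise_eq_iff {k : ℤ} : (∃ s : MotzkinStep, s.rise = k) ↔ |k| ≤ 1 := by
  constructor
  · rintro ⟨s, rfl⟩
    cases s <;> decide
  · intro hk
    obtain ⟨h_lower, h_upper⟩ := abs_le.1 hk
    interval_cases k
    exacts [⟨.D, rfl⟩, ⟨.H, rfl⟩, ⟨.U, rfl⟩]

lemma abs_pathHeight_succ_sub_le (w : List MotzkinStep) (i : ℕ) :
    |pathHeight w (i + 1) - pathHeight w i| ≤ 1 := by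
  induction w generalizing i with
  | nil => simp
  | cons s w ih =>
    cases i with
    | zero => simpa using MotzkinStep.exists_rise_eq_iff.1 ⟨s, rfl⟩
    | succ i => simpa using ih i

lemma exists_pathHeight_eq {n : ℕ} {h : ℕ → ℤ} (h_zero : h 0 = 0)
    (h_slope : ∀ i, |h (i + 1) - h i| ≤ 1) (h_const : ∀ i, n ≤ i → h i = h n) :
    ∃ w : List MotzkinStep, w.length = n ∧ pathHeight w = h := by
  induction n generalizing h with
  | zero =>
    refine ⟨[], rfl, funext fun i => ?_⟩
    rw [pathHeight_nil, h_const i i.zero_le, h_zero]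
  | succ n ih =>
    obtain ⟨s, hs⟩ : ∃ s : MotzkinStep, s.rise = h 1 :=
      MotzkinStep.exists_rise_eq_iff.2 (by simpa [h_zero] using h_slope 0)
    obtain ⟨w, hw, hwh⟩ := ih (h := fun i => h (i + 1) - h 1) (sub_self _)
      (fun i => by simpa using h_slope (i + 1))
      (fun i hi => by rw [h_const (i + 1) (by lia)])
    refine ⟨s :: w, by simp [hw], funext fun i => ?_⟩
    cases i with
    | zero => simp [h_zero]
    | succ i => simp [hwh, hs]

end Heights

/-! ### Covering pairs of Motzkin paths -/

section Covers

open Finset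

/-- The interior points of a path at which neither neighbour lies lower, that is, the points whose
raising by one leaves a path with steps `U`, `H`, `D`. The index `i` stands for the point
`i + 1`. -/
def weakValleys (w : List MotzkinStep) : Finset ℕ :=
  {i ∈ range (w.length - 1) |
    pathHeight w (i + 1) ≤ pathHeight w i ∧ pathHeight w (i + 1) ≤ pathHeight w (i + 2)}

namespace MotzkinPath

variable {n : ℕ} {γ γ' : MotzkinPath n}

/-- The order embedding of the Motzkin lattice into the integer sequences that sends a path to the
sequence of its ordinates. -/
noncomputable def heights (n : ℕ) : MotzkinPath n ↪o (ℕ → ℤ) :=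
  OrderEmbedding.ofMapLEIff (fun γ => pathHeight γ.steps) fun _ _ => Iff.rfl

lemma heights_apply (γ : MotzkinPath n) (i : ℕ) : heights n γ i = pathHeight γ.steps i := rfl

lemma heights_of_le (γ : MotzkinPath n) {i : ℕ} (hi : n ≤ i) : heights n γ i = 0 := by
  rw [heights_apply, pathHeight_of_length_le (γ.length_eq.trans_le hi), γ.length_eq,
    γ.ends_on_axis]

lemma abs_heights_succ_sub_le (γ : MotzkinPath n) (i : ℕ) :
    |heights n γ (i + 1) - heights n γ i| ≤ 1 :=
  abs_pathHeight_succ_sub_le γ.steps i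

lemma mem_weakValleys {i : ℕ} : i ∈ weakValleys γ.steps ↔ i + 1 < n ∧
    heights n γ (i + 1) ≤ heights n γ i ∧ heights n γ (i + 1) ≤ heights n γ (i + 2) := by
  simp only [weakValleys, mem_filter, mem_range, γ.length_eq, heights_apply, Nat.lt_sub_iff_add_lt]

lemma exists_raise (γ : MotzkinPath n) {i : ℕ} (hi : i ∈ weakValleys γ.steps) :
    ∃ γ' : MotzkinPath n, heights n γ' = heights n γ + Pi.single (i + 1) 1 := by
  obtain ⟨hin, h_left, h_right⟩ := mem_weakValleys.1 hi
  set h : ℕ → ℤ := heights n γ + Pi.single (i + 1) 1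
  have h_apply (j : ℕ) : h j = heights n γ j + if j = i + 1 then 1 else 0 := by
    simp only [h, Pi.add_apply, Pi.single_apply]
  have h_of_le {j : ℕ} (hj : n ≤ j) : h j = 0 := by
    rw [h_apply, heights_of_le γ hj, if_neg (by lia), add_zero]
  have h_slope (j : ℕ) : |h (j + 1) - h j| ≤ 1 := by
    have γ_slope := abs_heights_succ_sub_le γ j
    rw [h_apply, h_apply]
    rcases eq_or_ne j i with rfl | hji <;> grind
  have h_nonneg : 0 ≤ h := add_nonneg γ.nonneg (Pi.single_nonneg.2 zero_le_one)
  obtain ⟨w, hw, hwh⟩ := exists_pathHeight_eq (by simp [h_apply, heights_apply]) h_slope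
    fun j hj => (h_of_le hj).trans (h_of_le le_rfl).symm
  exact ⟨⟨w, hw, by rw [hwh, h_of_le le_rfl], fun j => hwh ▸ h_nonneg j⟩, hwh⟩

/-- The lowest point of `γ` that lies strictly below `γ'` is a weak valley: a lower neighbour of
it would lie on `γ'`, which then could not climb in one step above `γ`. -/
lemma exists_mem_weakValleys_of_lt (h : γ < γ') :
    ∃ i ∈ weakValleys γ.steps, heights n γ (i + 1) < heights n γ' (i + 1) := by
  obtain ⟨h_le, i₀, hi₀⟩ := Pi.lt_def.1 ((heights n).lt_iff_lt.2 h)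
  have lt_length {i : ℕ} (hi : heights n γ i < heights n γ' i) : i < n := by
    by_contra! hin
    simp [heights_of_le _ hin] at hi
  obtain ⟨i, hi, hi_min⟩ := exists_min_image {i ∈ range n | heights n γ i < heights n γ' i}
    (heights n γ) ⟨i₀, by simpa [hi₀] using lt_length hi₀⟩
  simp only [mem_filter, mem_range, and_imp] at hi hi_min
  have le_of_neighbour {j : ℕ} (hj : heights n γ' i ≤ heights n γ' j + 1) :
      heights n γ i ≤ heights n γ j := by
    rcases (h_le j).lt_or_eq with hlt | heq
    · exact hi_min j (lt_length hlt) hlt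
    · lia
  cases i with
  | zero => simp [heights_apply] at hi
  | succ i =>
    have h_left := abs_le.1 (abs_heights_succ_sub_le γ' i)
    have h_right := abs_le.1 (abs_heights_succ_sub_le γ' (i + 1))
    exact ⟨i, mem_weakValleys.2 ⟨hi.1, le_of_neighbour (by lia), le_of_neighbour (by lia)⟩, hi.2⟩

lemma covBy_of_heights_eq_add_single {i : ℕ} (h : heights n γ' = heights n γ + Pi.single i 1) :
    γ ⋖ γ' := by
  refine CovBy.of_image (heights n) (Pi.covBy_iff.2 ⟨i, ?_, fun j hj => ?_⟩)
  · simp [h, Order.covBy_iff_add_one_eq]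
  · simp [h, hj]

theorem covBy_iff_exists_raise : γ ⋖ γ' ↔
    ∃ i ∈ weakValleys γ.steps, heights n γ' = heights n γ + Pi.single (i + 1) 1 := by
  refine ⟨fun h => ?_, fun ⟨i, _, h⟩ => covBy_of_heights_eq_add_single h⟩
  obtain ⟨i, hi, hlt⟩ := exists_mem_weakValleys_of_lt h.lt
  obtain ⟨δ, hδ⟩ := exists_raise γ hi
  have hδ_le : δ ≤ γ' := (heights n).le_iff_le.1 fun j => by
    rw [hδ]
    rcases eq_or_ne j (i + 1) with rfl | hj
    · simpa using hlt
    · simpa [hj] using (heights n).monotone h.le j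
  obtain rfl : δ = γ' :=
    (h.eq_or_eq (covBy_of_heights_eq_add_single hδ).le hδ_le).resolve_left
      (covBy_of_heights_eq_add_single hδ).ne'
  exact ⟨i, hi, hδ⟩

theorem card_upperCovers (γ : MotzkinPath n) :
    Nat.card {γ' // γ ⋖ γ'} = #(weakValleys γ.steps) := by
  choose raise h_raise using fun i : weakValleys γ.steps => exists_raise γ i.2
  have raise_bijective : Function.Bijective fun i : weakValleys γ.steps =>
      (⟨raise i, covBy_of_heights_eq_add_single (h_raise i)⟩ : {γ' // γ ⋖ γ'}) := by
    constructor
    · intro i j hij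
      have h_heights := congrArg (heights n) (congrArg Subtype.val hij)
      rw [h_raise, h_raise, add_right_inj] at h_heights
      have h_val := congrFun h_heights (i + 1)
      grind
    · rintro ⟨γ', h⟩
      obtain ⟨i, hi, hγ'⟩ := covBy_iff_exists_raise.1 h
      exact ⟨⟨i, hi⟩, Subtype.ext ((heights n).injective ((h_raise ⟨i, hi⟩).trans hγ'.symm))⟩
  rw [← Nat.card_eq_of_bijective _ raise_bijective, Nat.card_eq_fintype_card, Fintype.card_coe]

end MotzkinPath

lemma hasseEdges_eq_sum_card_upperCovers (P : Type*) [PartialOrder P] [Fintype P] :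
    hasseEdges P = ∑ x : P, Nat.card {y // x ⋖ y} := by
  rw [hasseEdges, Nat.card_congr (Equiv.subtypeProdEquivSigmaSubtype (· ⋖ ·)), Nat.card_sigma]

end Covers

/-! ### Walks on the integers and the reflection principle -/

section Walks

/-- The number of walks of `n` steps `-1`, `0`, `1` on the integers with total displacement `j`, as
an integer since differences of such numbers are taken. -/
def walkCount : ℕ → ℤ → ℤ
  | 0, j => if j = 0 then 1 else 0
  | n + 1, j => walkCount n (j - 1) + walkCount n j + walkCount n (j + 1)

lemma walkCount_zero (j : ℤ) : walkCount 0 j = if j = 0 then 1 else 0 := rfl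

lemma walkCount_succ (n : ℕ) (j : ℤ) :
    walkCount (n + 1) j = walkCount n (j - 1) + walkCount n j + walkCount n (j + 1) := rfl

lemma walkCount_neg (n : ℕ) (j : ℤ) : walkCount n (-j) = walkCount n j := by
  induction n generalizing j with
  | zero => simp [walkCount_zero]
  | succ n ih =>
    rw [walkCount_succ, walkCount_succ, ih j, ← ih (j - 1), ← ih (j + 1), neg_sub', neg_add]
    ring_nf

lemma walkCount_eq_zero {n : ℕ} {j : ℤ} (h : n < |j|) : walkCount n j = 0 := by
  induction n generalizing j with
  | zero => simpa [walkCount_zero] using h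
  | succ n ih => rw [walkCount_succ, ih (by grind), ih (by grind), ih (by grind)]; simp

lemma walkCount_succ_zero (n : ℕ) :
    walkCount (n + 1) 0 = walkCount n 0 + 2 * walkCount n 1 := by
  rw [walkCount_succ, zero_sub, zero_add, walkCount_neg]
  ring

/-- This is the identity `x P' = (n + 1) (x - x⁻¹) (x⁻¹ + 1 + x) ^ n` for
`P = (x⁻¹ + 1 + x) ^ (n + 1)`, read off at `x ^ j`. -/
lemma mul_walkCount_succ (n : ℕ) (j : ℤ) :
    j * walkCount (n + 1) j = (n + 1) * (walkCount n (j - 1) - walkCount n (j + 1)) := by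
  induction n generalizing j with
  | zero => grind [walkCount]
  | succ n ih =>
    have ih_left := ih (j - 1)
    have ih_right := ih (j + 1)
    have step_left := walkCount_succ n (j - 1)
    have step_right := walkCount_succ n (j + 1)
    rw [sub_add_cancel] at ih_left step_left
    rw [add_sub_cancel_right] at ih_right step_right
    push_cast
    linear_combination j * walkCount_succ (n + 1) j + ih_left + ih j + ih_right
      - (n + 1 : ℤ) * (step_left - step_right)

lemma trinomialCoeff_succ_zero (n : ℕ) : trinomialCoeff (n + 1) 0 = trinomialCoeff n 0 := by
  simp [trinomialCoeff, pow_succ]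

lemma trinomialCoeff_succ_one (n : ℕ) :
    trinomialCoeff (n + 1) 1 = trinomialCoeff n 1 + trinomialCoeff n 0 := by
  simp [trinomialCoeff, pow_succ, mul_add, ← mul_assoc]

lemma trinomialCoeff_succ_add_two (n k : ℕ) : trinomialCoeff (n + 1) (k + 2) =
    trinomialCoeff n (k + 2) + trinomialCoeff n (k + 1) + trinomialCoeff n k := by
  simp [trinomialCoeff, pow_succ _ n, mul_add]

lemma trinomialCoeff_eq_walkCount (n k : ℕ) :
    (trinomialCoeff n k : ℤ) = walkCount n ((k : ℤ) - n) := by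
  induction n generalizing k with
  | zero => simp [trinomialCoeff, walkCount_zero, Polynomial.coeff_one]
  | succ n ih =>
    rw [walkCount_succ, show (k : ℤ) - (n + 1 : ℕ) = k - 1 - n by push_cast; ring,
      show (k : ℤ) - 1 - n - 1 = k - 2 - n by ring, show (k : ℤ) - 1 - n + 1 = k - n by ring]
    match k with
    | 0 =>
      have vanish_one : walkCount n ((0 : ℕ) - 1 - n) = 0 := walkCount_eq_zero (by clear ih; grind)
      have vanish_two : walkCount n ((0 : ℕ) - 2 - n) = 0 := walkCount_eq_zero (by clear ih; grind)
      rw [trinomialCoeff_succ_zero, ih, vanish_one, vanish_two, zero_add, zero_add]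
    | 1 =>
      have vanish : walkCount n ((1 : ℕ) - 2 - n) = 0 := walkCount_eq_zero (by clear ih; grind)
      rw [trinomialCoeff_succ_one, vanish, Nat.cast_add, ih, ih]
      norm_num [add_comm]
    | k + 2 =>
      rw [trinomialCoeff_succ_add_two, Nat.cast_add, Nat.cast_add, ih, ih, ih]
      push_cast
      ring_nf

/-- The number of walks of `n` steps `-1`, `0`, `1` from height `h` to `0` that do not go below
`0`, for `-1 ≤ h`. By the reflection principle at `-1`, it is the number of all walks from `h` to
`0` less the number of those from `h` to `-2`. -/
def ballot (n : ℕ) (h : ℤ) : ℤ := walkCount n h - walkCount n (h + 2)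

lemma ballot_succ (n : ℕ) (h : ℤ) :
    ballot (n + 1) h = ballot n (h - 1) + ballot n h + ballot n (h + 1) := by
  simp only [ballot, walkCount_succ]
  ring_nf

lemma ballot_neg_one (n : ℕ) : ballot n (-1) = 0 := by
  rw [ballot, walkCount_neg, neg_add_eq_sub, show (2 - 1 : ℤ) = 1 from rfl, sub_self]

lemma ballot_zero {h : ℤ} (hh : -1 ≤ h) : ballot 0 h = if h = 0 then 1 else 0 := by
  rw [ballot, walkCount_zero, walkCount_zero, if_neg (show h + 2 ≠ 0 by lia), sub_zero]

lemma ballot_succ_zero (n : ℕ) : ballot (n + 1) 0 = ballot n 0 + ballot n 1 := by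
  rw [ballot_succ, zero_sub, ballot_neg_one, zero_add, zero_add]

lemma succ_mul_ballot_zero (n : ℕ) : (n + 1) * ballot n 0 = walkCount (n + 1) 1 := by
  have := mul_walkCount_succ n 1
  rw [one_mul, sub_self, one_add_one_eq_two] at this
  rw [this, ballot, zero_add]

/-- A walk from `h + 1` to `0` is cut at its first step from `1` to `0`: the part before that step
is a walk from `h` to `0`, shifted by one. -/
lemma sum_ballot_mul_ballot (n : ℕ) {h : ℤ} (hh : 0 ≤ h) :
    ∑ p ∈ Finset.HasAntidiagonal.antidiagonal n, ballot p.1 h * ballot p.2 0 =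
      ballot (n + 1) (h + 1) := by
  induction n generalizing h with
  | zero =>
    rw [Finset.Nat.antidiagonal_zero, Finset.sum_singleton, ballot_succ, add_sub_cancel_right,
      ballot_zero (h := 0) (by lia), ballot_zero (h := h + 1) (by lia),
      ballot_zero (h := h + 1 + 1) (by lia)]
    grind
  | succ n ih =>
    rw [Finset.Nat.sum_antidiagonal_succ]
    simp only [ballot_succ _ h, add_mul, Finset.sum_add_distrib]
    rw [ih hh, ih (show 0 ≤ h + 1 by lia), ballot_succ (n + 1) (h + 1), add_sub_cancel_right]
    rcases hh.eq_or_lt with rfl | h_pos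
    · simp only [zero_sub, ballot_neg_one, zero_mul, Finset.sum_const_zero,
        ballot_zero (show (-1 : ℤ) ≤ 0 by lia), if_true, zero_add]
      ring
    · rw [ih (show 0 ≤ h - 1 by lia), sub_add_cancel, ballot_zero (h := h) (by lia),
        if_neg h_pos.ne']
      ring

end Walks

/-! ### Counting covering pairs -/

section EdgeCount

open Finset

/-- The words of `n` steps that, started at height `h`, end on the axis and never go below it. -/
def wordsFrom : ℕ → ℤ → Finset (List MotzkinStep)
  | 0, h => if h = 0 then {[]} else ∅
  | n + 1, h => if h < 0 then ∅ else
      univ.biUnion fun s : MotzkinStep => (wordsFrom n (h + s.rise)).image (List.cons s)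

lemma wordsFrom_of_neg (n : ℕ) {h : ℤ} (hh : h < 0) : wordsFrom n h = ∅ := by
  cases n with
  | zero => rw [wordsFrom, if_neg hh.ne]
  | succ n => rw [wordsFrom, if_pos hh]

lemma sum_wordsFrom_succ {N : Type*} [AddCommMonoid N] (f : List MotzkinStep → N) (n : ℕ) {h : ℤ}
    (hh : 0 ≤ h) : ∑ w ∈ wordsFrom (n + 1) h, f w =
      ∑ w ∈ wordsFrom n (h + 1), f (.U :: w) + ∑ w ∈ wordsFrom n h, f (.H :: w)
        + ∑ w ∈ wordsFrom n (h - 1), f (.D :: w) := by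
  have sum_univ (g : MotzkinStep → N) : ∑ s, g s = g .U + g .H + g .D := by
    simp only [univ, Fintype.elems, mem_insert, mem_singleton, reduceCtorEq, or_self,
      not_false_eq_true, sum_insert, sum_singleton, add_assoc]
  rw [wordsFrom, if_neg hh.not_gt, sum_biUnion, sum_univ]
  · simp only [sum_image List.cons_injective.injOn, MotzkinStep.rise_U,
      MotzkinStep.rise_H, MotzkinStep.rise_D, add_zero, sub_eq_add_neg]
  · intro s _ s' _ hss'
    simp only [Function.onFun, disjoint_left, mem_image]
    rintro _ ⟨w, _, rfl⟩ ⟨w', _, hw'⟩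
    exact hss' (List.cons.inj hw').1.symm

lemma mem_wordsFrom {n : ℕ} {h : ℤ} {w : List MotzkinStep} : w ∈ wordsFrom n h ↔
    w.length = n ∧ h + pathHeight w n = 0 ∧ ∀ i, 0 ≤ h + pathHeight w i := by
  induction n generalizing h w with
  | zero =>
    rw [wordsFrom]
    split_ifs with hh
    · simp only [mem_singleton, List.length_eq_zero_iff]
      exact ⟨fun hw => by simp [hw, hh], And.left⟩
    · simp [hh]
  | succ n ih =>
    rw [wordsFrom]
    split_ifs with hh
    · simp only [notMem_empty, false_iff]
      exact fun ⟨_, _, h_nonneg⟩ => hh.not_ge (by simpa using h_nonneg 0)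
    · simp only [mem_biUnion, mem_univ, true_and, mem_image, ih]
      constructor
      · rintro ⟨s, v, ⟨h_length, h_end, h_nonneg⟩, rfl⟩
        refine ⟨by simpa using h_length, by simpa [add_assoc] using h_end, fun i => ?_⟩
        cases i with
        | zero => simpa using hh
        | succ i => simpa [add_assoc] using h_nonneg i
      · rintro ⟨h_length, h_end, h_nonneg⟩
        obtain ⟨s, v, rfl⟩ := List.exists_cons_of_length_eq_add_one h_length
        exact ⟨s, v, ⟨by simpa using h_length, by simpa [add_assoc] using h_end,
          fun i => by simpa [add_assoc] using h_nonneg (i + 1)⟩, rfl⟩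

lemma card_wordsFrom (n : ℕ) {h : ℤ} (hh : -1 ≤ h) : (#(wordsFrom n h) : ℤ) = ballot n h := by
  induction n generalizing h with
  | zero =>
    rw [ballot_zero hh, wordsFrom]
    split_ifs <;> rfl
  | succ n ih =>
    rcases hh.eq_or_lt with rfl | h_nonneg
    · rw [wordsFrom_of_neg _ neg_one_lt_zero, ballot_neg_one, card_empty, Nat.cast_zero]
    · rw [card_eq_sum_ones, sum_wordsFrom_succ _ _ h_nonneg, ← card_eq_sum_ones,
        ← card_eq_sum_ones, ← card_eq_sum_ones, Nat.cast_add, Nat.cast_add, ih (by lia), ih hh,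
        ih (by lia), ballot_succ]
      ring

/-- Motzkin paths of length `n` as words started at height `0`. -/
def motzkinPathEquiv (n : ℕ) : MotzkinPath n ≃ wordsFrom n 0 where
  toFun γ := ⟨γ.steps, mem_wordsFrom.2
    ⟨γ.length_eq, by simpa using γ.ends_on_axis, by simpa using γ.nonneg⟩⟩
  invFun w := ⟨w.1, (mem_wordsFrom.1 w.2).1, by simpa using (mem_wordsFrom.1 w.2).2.1,
    by simpa using (mem_wordsFrom.1 w.2).2.2⟩
  left_inv _ := rfl
  right_inv _ := rfl

theorem motzkinNumber_eq_ballot (n : ℕ) : (motzkinNumber n : ℤ) = ballot n 0 := by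
  rw [motzkinNumber, Nat.card_congr (motzkinPathEquiv n), Nat.card_eq_fintype_card,
    Fintype.card_coe, card_wordsFrom n (by lia)]

/-- The total number of weak valleys of the words in `wordsFrom n h`. -/
def valleySum (n : ℕ) (h : ℤ) : ℤ := ∑ w ∈ wordsFrom n h, (#(weakValleys w) : ℤ)

theorem hasseEdges_eq_valleySum (n : ℕ) : (hasseEdges (MotzkinPath n) : ℤ) = valleySum n 0 := by
  have := Fintype.ofEquiv _ (motzkinPathEquiv n).symm
  rw [hasseEdges_eq_sum_card_upperCovers, valleySum, Nat.cast_sum,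
    ← sum_coe_sort (wordsFrom n 0), ← (motzkinPathEquiv n).sum_comp]
  exact sum_congr rfl fun γ _ => congrArg Nat.cast γ.card_upperCovers

lemma card_weakValleys_cons_cons (s s' : MotzkinStep) (w : List MotzkinStep) :
    #(weakValleys (s :: s' :: w)) =
      #(weakValleys (s' :: w)) + if s.rise ≤ 0 ∧ 0 ≤ s'.rise then 1 else 0 := by
  simp only [weakValleys, card_filter, List.length_cons, add_tsub_cancel_right, sum_range_succ',
    pathHeight_cons_succ, pathHeight_zero, add_le_add_iff_left, add_zero]

lemma valleySum_one (h : ℤ) : valleySum 1 h = 0 := by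
  refine sum_eq_zero fun w hw => ?_
  rw [weakValleys, (mem_wordsFrom.1 hw).1]
  rfl

lemma valleySum_neg_one (n : ℕ) : valleySum n (-1) = 0 := by
  rw [valleySum, wordsFrom_of_neg _ neg_one_lt_zero, sum_empty]

lemma sum_card_weakValleys_cons (n : ℕ) (h : ℤ) (s : MotzkinStep) :
    ∑ w ∈ wordsFrom (n + 1) h, (#(weakValleys (s :: w)) : ℤ) =
      valleySum (n + 1) h + if s.rise ≤ 0 ∧ 0 ≤ h then ballot n h + ballot n (h + 1) else 0 := by
  rcases lt_or_ge h 0 with h_neg | h_nonneg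
  · simp [valleySum, wordsFrom_of_neg _ h_neg, h_neg.not_ge]
  · rw [valleySum, sum_wordsFrom_succ _ _ h_nonneg, sum_wordsFrom_succ _ _ h_nonneg]
    simp only [card_weakValleys_cons_cons, Nat.cast_add, sum_add_distrib, sum_const, nsmul_eq_mul,
      card_wordsFrom n (show -1 ≤ h by lia), card_wordsFrom n (show -1 ≤ h + 1 by lia)]
    by_cases hs : s.rise ≤ 0
    · simp only [hs, h_nonneg, and_self, MotzkinStep.rise_U, MotzkinStep.rise_H,
        MotzkinStep.rise_D, zero_le_one, le_refl, Int.reduceNeg, Int.reduceLE, Int.neg_nonneg,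
        and_false, ↓reduceIte, Nat.cast_one, Nat.cast_zero, mul_one, mul_zero, add_zero]
      ring
    · simp [hs]

lemma valleySum_add_two (n : ℕ) {h : ℤ} (hh : 0 ≤ h) : valleySum (n + 2) h =
    valleySum (n + 1) (h + 1) + valleySum (n + 1) h + valleySum (n + 1) (h - 1)
      + (ballot n (h + 1) + 2 * ballot n h + ballot n (h - 1))
      - if h = 0 then ballot n 0 else 0 := by
  rw [valleySum, sum_wordsFrom_succ _ _ hh]
  simp only [sum_card_weakValleys_cons, MotzkinStep.rise_U, MotzkinStep.rise_H, MotzkinStep.rise_D,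
    sub_add_cancel]
  grind [ballot_neg_one]

/-- A weak valley of a word of `n + 2` steps is a pair of consecutive steps `DU`, `DH`, `HU` or
`HH`, and contracting it to a single step of the same total rise marks a step of a word of `n + 1`
steps. A marked level step arises twice, from `HH` and from `DU`, but on the axis only from `HH`.
A marked level step can be deleted, which leaves `n + 1` choices for a word of `n` steps; cutting at
a marked level step on the axis counts the exceptions, by `sum_ballot_mul_ballot`. -/
theorem valleySum_add_two_eq (n : ℕ) {h : ℤ} (hh : 0 ≤ h) : valleySum (n + 2) h =
    (n + 1) * (ballot n (h + 1) + 2 * ballot n h + ballot n (h - 1)) - ballot (n + 1) (h + 1) := by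
  induction n generalizing h with
  | zero =>
    simp only [valleySum_add_two 0 hh, zero_add, valleySum_one, ballot_succ 0 (h + 1),
      add_sub_cancel_right, ballot_zero (show -1 ≤ (0 : ℤ) by lia),
      ballot_zero (show -1 ≤ h by lia), ballot_zero (show -1 ≤ h + 1 by lia),
      ballot_zero (show -1 ≤ h + 1 + 1 by lia)]
    grind
  | succ n ih =>
    rw [valleySum_add_two _ hh, ih hh, ih (show 0 ≤ h + 1 by lia), ballot_succ (n + 1) (h + 1)]
    rcases hh.eq_or_lt with rfl | h_pos
    · simp only [zero_sub, zero_add, valleySum_neg_one, ballot_neg_one, if_true, ballot_succ n 0,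
        ballot_succ n 1, ballot_succ n (1 + 1), sub_self, add_sub_cancel_right]
      push_cast
      ring
    · rw [ih (show 0 ≤ h - 1 by lia), if_neg h_pos.ne', ballot_succ n h, ballot_succ n (h + 1),
        ballot_succ n (h - 1)]
      push_cast
      ring_nf

theorem hasseEdges_add_two_add_motzkinNumber (n : ℕ) :
    hasseEdges (MotzkinPath (n + 2)) + motzkinNumber (n + 2) =
      (n + 2) * motzkinNumber (n + 1) + (n + 1) * motzkinNumber n := by
  zify
  simp only [hasseEdges_eq_valleySum, motzkinNumber_eq_ballot, valleySum_add_two_eq n le_rfl,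
    zero_add, zero_sub, ballot_neg_one, ballot_succ_zero]
  ring

theorem hasseEdges_zero : hasseEdges (MotzkinPath 0) = 0 := by
  zify
  rw [hasseEdges_eq_valleySum]
  rfl

theorem hasseEdges_succ (n : ℕ) :
    (hasseEdges (MotzkinPath (n + 1)) : ℤ) = walkCount (n + 1) 2 + walkCount n 2 := by
  cases n with
  | zero => rw [hasseEdges_eq_valleySum, valleySum_one]; rfl
  | succ n =>
    have edges := hasseEdges_add_two_add_motzkinNumber n
    zify at edges
    have motzkin := succ_mul_ballot_zero (n + 1)
    push_cast at motzkin
    rw [motzkinNumber_eq_ballot, motzkinNumber_eq_ballot, motzkinNumber_eq_ballot,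
      succ_mul_ballot_zero, ballot, zero_add] at edges
    have walk_one := walkCount_succ (n + 1) 1
    rw [sub_self, one_add_one_eq_two] at walk_one
    linear_combination edges + motzkin - walkCount_succ_zero (n + 1) + walk_one

end EdgeCount

section ClosedForms

lemma trinomialCoeff_self (n : ℕ) : (trinomialCoeff n n : ℤ) = walkCount n 0 := by
  rw [trinomialCoeff_eq_walkCount, sub_self]

lemma trinomialCoeff_self_sub_motzkinNumber (n : ℕ) :
    (trinomialCoeff n n : ℤ) - motzkinNumber n = walkCount n 2 := by
  rw [trinomialCoeff_self, motzkinNumber_eq_ballot, ballot, zero_add, sub_sub_cancel]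

theorem hasseEdges_succ_eq_trinomialCoeff_sub (n : ℕ) : (hasseEdges (MotzkinPath (n + 1)) : ℤ) =
    trinomialCoeff (n + 1) (n + 1) - motzkinNumber (n + 1)
      + (trinomialCoeff n n - motzkinNumber n) := by
  rw [trinomialCoeff_self_sub_motzkinNumber, trinomialCoeff_self_sub_motzkinNumber,
    hasseEdges_succ]

lemma trinomialCoeff_add_two (n : ℕ) : (trinomialCoeff (n + 2) n : ℤ) = walkCount (n + 2) 2 := by
  rw [trinomialCoeff_eq_walkCount, ← walkCount_neg]
  congr 1
  push_cast
  ring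

theorem hasseEdges_add_three (n : ℕ) : hasseEdges (MotzkinPath (n + 3)) =
    trinomialCoeff (n + 3) (n + 1) + trinomialCoeff (n + 2) n := by
  zify
  rw [trinomialCoeff_add_two (n + 1), trinomialCoeff_add_two, hasseEdges_succ]

end ClosedForms

/-! ### Generating series -/

section GeneratingSeries

open PowerSeries

/-- The generating series of the walks with total displacement `j`. -/
noncomputable def walkSeries (j : ℤ) : ℚ⟦X⟧ := mk fun n => (walkCount n j : ℚ)

/-- The generating series of the nonnegative walks from height `h` to `0`. -/
noncomputable def ballotSeries (h : ℤ) : ℚ⟦X⟧ := mk fun n => (ballot n h : ℚ)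

lemma walkSeries_neg (j : ℤ) : walkSeries (-j) = walkSeries j := by
  simp only [walkSeries, walkCount_neg]

lemma walkSeries_eq (j : ℤ) : walkSeries j =
    (if j = 0 then 1 else 0) + X * (walkSeries (j - 1) + walkSeries j + walkSeries (j + 1)) := by
  ext n
  cases n with
  | zero => split_ifs with hj <;> simp [walkSeries, walkCount_zero, hj]
  | succ n =>
    rw [map_add, coeff_succ_X_mul]
    split_ifs <;> simp [walkSeries, walkCount_succ, coeff_one]

lemma ballotSeries_eq_sub (h : ℤ) : ballotSeries h = walkSeries h - walkSeries (h + 2) := by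
  ext n
  simp [ballotSeries, walkSeries, ballot]

lemma ballotSeries_zero_eq :
    ballotSeries 0 = 1 + X * (ballotSeries 0 + ballotSeries 1) := by
  have walk_neg_one : walkSeries (-1) = walkSeries 1 := walkSeries_neg 1
  have walk_zero := walkSeries_eq 0
  have walk_two := walkSeries_eq 2
  norm_num at walk_zero walk_two
  norm_num [ballotSeries_eq_sub]
  linear_combination walk_zero - walk_two + X * walk_neg_one

lemma X_mul_ballotSeries_mul {h : ℤ} (hh : 0 ≤ h) :
    X * (ballotSeries h * ballotSeries 0) = ballotSeries (h + 1) := by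
  ext n
  cases n with
  | zero =>
    simp [ballotSeries, ballot_zero (show -1 ≤ h + 1 by lia), show h + 1 ≠ 0 by lia]
  | succ n =>
    rw [coeff_succ_X_mul, coeff_mul]
    simp only [ballotSeries, coeff_mk]
    exact_mod_cast sum_ballot_mul_ballot n hh

lemma motzkinSeries_eq_ballotSeries : motzkinSeries = ballotSeries 0 := by
  ext n
  simpa [motzkinSeries, ballotSeries] using congrArg (Int.cast : ℤ → ℚ) (motzkinNumber_eq_ballot n)

lemma centralTrinomialSeries_eq_walkSeries : centralTrinomialSeries = walkSeries 0 := by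
  ext n
  simpa [centralTrinomialSeries, walkSeries] using
    congrArg (Int.cast : ℤ → ℚ) (trinomialCoeff_self n)

theorem motzkinSeries_eq : motzkinSeries = 1 + X * motzkinSeries + X ^ 2 * motzkinSeries ^ 2 := by
  have first_passage := X_mul_ballotSeries_mul le_rfl
  rw [zero_add] at first_passage
  rw [motzkinSeries_eq_ballotSeries]
  linear_combination ballotSeries_zero_eq - X * first_passage

/-- The formal power series `√(1 - 2x - 3x²)` with constant term `1`, by completing the square in
the quadratic equation for the Motzkin series. -/
noncomputable def sqrtSeries : ℚ⟦X⟧ := 1 - X - 2 * X ^ 2 * motzkinSeries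

lemma constantCoeff_sqrtSeries : constantCoeff sqrtSeries = 1 := by
  simp [sqrtSeries]

lemma sqrtSeries_ne_zero : sqrtSeries ≠ 0 := fun h => by
  simpa [h] using constantCoeff_sqrtSeries

theorem sqrtSeries_sq : sqrtSeries ^ 2 = 1 - 2 * X - 3 * X ^ 2 := by
  rw [sqrtSeries]
  linear_combination (-4 * X ^ 2 : ℚ⟦X⟧) * motzkinSeries_eq

theorem centralTrinomialSeries_mul_sqrtSeries : centralTrinomialSeries * sqrtSeries = 1 := by
  have walk_neg_one : walkSeries (-1) = walkSeries 1 := walkSeries_neg 1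
  have walk_zero := walkSeries_eq 0
  have walk_one := walkSeries_eq 1
  have motzkin := ballotSeries_eq_sub 0
  norm_num at walk_zero walk_one motzkin
  have mul_sq : walkSeries 0 * sqrtSeries ^ 2 = sqrtSeries := by
    rw [sqrtSeries_sq, sqrtSeries, motzkinSeries_eq_ballotSeries]
    linear_combination (1 - X) * walk_zero + 2 * X * walk_one + (1 - X) * X * walk_neg_one
      + 2 * X ^ 2 * motzkin
  rw [centralTrinomialSeries_eq_walkSeries]
  refine mul_right_cancel₀ sqrtSeries_ne_zero ?_
  linear_combination mul_sq

theorem edgeSeries_motzkinPath :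
    edgeSeries MotzkinPath = (1 + X) * (centralTrinomialSeries - motzkinSeries) := by
  rw [centralTrinomialSeries_eq_walkSeries, motzkinSeries_eq_ballotSeries, ballotSeries_eq_sub,
    zero_add, sub_sub_cancel, add_mul, one_mul]
  ext n
  cases n with
  | zero => simp [edgeSeries, walkSeries, hasseEdges_zero, walkCount_zero]
  | succ n =>
    simp only [map_add, coeff_succ_X_mul, edgeSeries, walkSeries, coeff_mk]
    exact_mod_cast hasseEdges_succ n

theorem edgeSeries_motzkinPath_eq_div : (edgeSeries MotzkinPath : ℚ⸨X⸩) =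
    (((1 + X) * (1 - 2 * X - X ^ 2 - (1 - X) * sqrtSeries) : ℚ⟦X⟧) : ℚ⸨X⸩) /
      ((2 * X ^ 2 * sqrtSeries : ℚ⟦X⟧) : ℚ⸨X⸩) := by
  have := algebraRat.charZero ℚ⟦X⟧
  have denom_ne_zero : (2 * X ^ 2 * sqrtSeries : ℚ⟦X⟧) ≠ 0 :=
    mul_ne_zero (mul_ne_zero two_ne_zero (pow_ne_zero 2 X_ne_zero)) sqrtSeries_ne_zero
  rw [eq_div_iff ((map_ne_zero_iff _ HahnSeries.ofPowerSeries_injective).2 denom_ne_zero),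
    ← map_mul]
  congr 1
  rw [edgeSeries_motzkinPath]
  have sqrtSeries_def : sqrtSeries = 1 - X - 2 * X ^ 2 * motzkinSeries := rfl
  linear_combination (1 + X : ℚ⟦X⟧) * (2 * X ^ 2 * centralTrinomialSeries_mul_sqrtSeries
    + sqrtSeries_sq - sqrtSeries * sqrtSeries_def)

end GeneratingSeries

/-! ### The explicit sum -/

section ExplicitSum

open Finset

lemma walkCount_natCast_eq_sum_choose (n j : ℕ) :
    walkCount n j = ∑ k ∈ range (n + 1), (n.choose k * (n - k).choose (k + j) : ℤ) := by
  have coeff_eq := trinomialCoeff_eq_walkCount n (n + j)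
  rw [Nat.cast_add, add_sub_cancel_left] at coeff_eq
  rw [← coeff_eq, trinomialCoeff, show (1 + Polynomial.X + Polynomial.X ^ 2 : Polynomial ℕ)
    = 1 + (1 + Polynomial.X) * Polynomial.X by ring, add_pow, Polynomial.finsetSum_coeff,
    Nat.cast_sum]
  refine sum_congr rfl fun k hk => ?_
  have hkn := mem_range_succ_iff.1 hk
  rw [one_pow, one_mul, mul_pow, Polynomial.coeff_mul_natCast, Polynomial.coeff_mul_X_pow',
    if_pos (by lia), Polynomial.coeff_one_add_X_pow, show n + j - (n - k) = k + j by lia,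
    mul_comm, Nat.cast_mul, Nat.cast_id, Nat.cast_id]

lemma choose_mul_choose_add (k d : ℕ) :
    ((k + d + 1).choose k * (d + 1).choose (k + 2) + (k + d).choose k * d.choose (k + 2) : ℚ) =
      2 * d / (k + 2) * ((k + d).choose k * d.choose (k + 1)) := by
  have upper_succ : ((k + d + 1).choose k : ℚ) = (k + d).choose k * (k + d + 1) / (d + 1) := by
    rw [eq_div_iff (by positivity)]
    have := Nat.choose_mul_succ_eq (k + d) k
    rw [show k + d + 1 - k = d + 1 by lia] at this
    exact_mod_cast this.symm
  have both_succ : ((d + 1).choose (k + 2) : ℚ) = (d + 1) * d.choose (k + 1) / (k + 2) := by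
    rw [eq_div_iff (by positivity)]
    exact_mod_cast (Nat.add_one_mul_choose_eq d (k + 1)).symm
  have lower_succ : (d.choose (k + 2) : ℚ) = d.choose (k + 1) * (d - (k + 1)) / (k + 2) := by
    rw [eq_div_iff (by positivity)]
    have := Nat.choose_succ_right_eq d (k + 1)
    rcases le_or_gt (k + 1) d with h | h
    · rw [← Nat.cast_add_one, ← Nat.cast_sub h]
      exact_mod_cast this
    · rw [Nat.choose_eq_zero_of_lt h, Nat.choose_eq_zero_of_lt (h.trans (by lia))]
      simp
  rw [upper_succ, both_succ, lower_succ]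
  field_simp
  ring

lemma choose_succ_mul_choose_succ (k d : ℕ) :
    2 / (k + d + 1 : ℚ) *
        ((k + d + 1).choose (k + 1) * d.choose (k + 1) * ((k + 1) * d / (k + 2))) =
      2 * d / (k + 2) * ((k + d).choose k * d.choose (k + 1)) := by
  have both_succ : ((k + d + 1).choose (k + 1) : ℚ) =
      (k + d + 1) * (k + d).choose k / (k + 1) := by
    rw [eq_div_iff (by positivity)]
    exact_mod_cast (Nat.add_one_mul_choose_eq (k + d) k).symm
  rw [both_succ]
  field_simp

theorem hasseEdges_eq_sum_choose {n : ℕ} (hn : 1 ≤ n) : (hasseEdges (MotzkinPath n) : ℚ) =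
    (2 / (n : ℚ)) * ∑ k ∈ range (n / 2 + 1),
      (n.choose k : ℚ) * ((n - k).choose k : ℚ)
        * (((k : ℚ) * ((n : ℚ) - (k : ℚ))) / ((k : ℚ) + 1)) := by
  obtain ⟨m, rfl⟩ := Nat.exists_eq_add_of_le' hn
  have edges : (hasseEdges (MotzkinPath (m + 1)) : ℚ) =
      (walkCount (m + 1) (2 : ℕ) : ℤ) + (walkCount m (2 : ℕ) : ℤ) := by
    exact_mod_cast hasseEdges_succ m
  have half_subset : range ((m + 1) / 2 + 1) ⊆ range (m + 2) :=
    range_subset_range.2 (by lia)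
  rw [edges, walkCount_natCast_eq_sum_choose, walkCount_natCast_eq_sum_choose,
    sum_range_succ _ (m + 1), tsub_self, Nat.choose_zero_succ,
    sum_subset half_subset fun k _ hk => by
      rw [Nat.choose_eq_zero_of_lt (n := m + 1 - k) (by rw [mem_range] at hk; lia)]
      simp,
    sum_range_succ' _ (m + 1)]
  push_cast
  simp only [mul_zero, add_zero, zero_mul, zero_div, ← sum_add_distrib, mul_sum]
  refine sum_congr rfl fun k hk => ?_
  obtain ⟨d, rfl⟩ := Nat.exists_eq_add_of_le (mem_range_succ_iff.1 hk)
  rw [show k + d + 1 - k = d + 1 by lia, show k + d - k = d by lia,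
    choose_mul_choose_add, ← choose_succ_mul_choose_succ]
  push_cast
  ring

end ExplicitSum

/-! ### Asymptotics -/

section Asymptotics

open MeasureTheory Topology

lemma integral_cos_int_mul (j : ℤ) :
    ∫ θ in (-Real.pi)..Real.pi, Real.cos (j * θ) = if j = 0 then 2 * Real.pi else 0 := by
  split_ifs with hj
  · simp only [hj, Int.cast_zero, zero_mul, Real.cos_zero, integral_one]
    ring
  · rw [intervalIntegral.integral_comp_mul_left _ (Int.cast_ne_zero.2 hj), integral_cos, mul_neg,
      Real.sin_neg, Real.sin_int_mul_pi, neg_zero, sub_zero, smul_zero]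

/-- The characteristic function of a random step, uniform among the steps `-1`, `0`, `1`. -/
noncomputable def stepCharFun (θ : ℝ) : ℝ := (1 + 2 * Real.cos θ) / 3

lemma continuous_stepCharFun : Continuous stepCharFun := by
  unfold stepCharFun
  fun_prop

lemma integral_stepCharFun_pow_mul_cos (n : ℕ) (j : ℤ) :
    ∫ θ in (-Real.pi)..Real.pi, stepCharFun θ ^ n * Real.cos (j * θ) =
      2 * Real.pi * (walkCount n j / 3 ^ n) := by
  induction n generalizing j with
  | zero =>
    simp only [pow_zero, one_mul, integral_cos_int_mul, walkCount_zero]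
    split_ifs <;> simp
  | succ n ih =>
    have integrable (j : ℤ) : IntervalIntegrable
        (fun θ : ℝ => stepCharFun θ ^ n * Real.cos (j * θ)) volume (-Real.pi) Real.pi :=
      ((continuous_stepCharFun.pow n).mul (by fun_prop)).intervalIntegrable _ _
    have last_step (θ : ℝ) : stepCharFun θ ^ (n + 1) * Real.cos (j * θ) =
        (stepCharFun θ ^ n * Real.cos ((j - 1 : ℤ) * θ) + stepCharFun θ ^ n * Real.cos (j * θ)
          + stepCharFun θ ^ n * Real.cos ((j + 1 : ℤ) * θ)) / 3 := by
      rw [pow_succ, stepCharFun]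
      push_cast
      rw [sub_mul, add_mul, one_mul, Real.cos_sub, Real.cos_add]
      ring
    simp only [last_step]
    rw [intervalIntegral.integral_div, intervalIntegral.integral_add
      ((integrable _).add (integrable _)) (integrable _),
      intervalIntegral.integral_add (integrable _) (integrable _), ih, ih, ih, walkCount_succ]
    push_cast
    ring

lemma abs_stepCharFun_le {θ : ℝ} (h : |θ| ≤ Real.pi) :
    |stepCharFun θ| ≤ Real.exp (-(2 / (3 * Real.pi ^ 2)) * θ ^ 2) := by
  set t := θ ^ 2 / Real.pi ^ 2 with ht
  have t_nonneg : 0 ≤ t := by positivity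
  have t_le_one : t ≤ 1 := by
    rw [ht, ← div_pow, sq_le_one_iff_abs_le_one, abs_div, abs_of_pos Real.pi_pos]
    exact div_le_one_of_le₀ h Real.pi_pos.le
  have cos_le : Real.cos θ ≤ 1 - 2 * t :=
    (Real.cos_le_one_sub_mul_cos_sq h).trans_eq (by rw [ht]; ring)
  have neg_one_le_cos := Real.neg_one_le_cos θ
  have exp_ge := Real.add_one_le_exp (-(2 / 3) * t)
  rw [show -(2 / (3 * Real.pi ^ 2)) * θ ^ 2 = -(2 / 3) * t by rw [ht]; field_simp,
    stepCharFun, abs_le]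
  constructor <;> linarith

lemma tendsto_div_sqrt_natCast (u : ℝ) : Tendsto (fun n : ℕ => u / √n) atTop (𝓝 0) :=
  (Real.tendsto_sqrt_atTop.comp tendsto_natCast_atTop_atTop).const_div_atTop u

lemma cos_eq_one_sub_sq_mul_sinc_sq (x : ℝ) :
    Real.cos x = 1 - x ^ 2 / 2 * Real.sinc (x / 2) ^ 2 := by
  have half_angle : Real.cos x = 1 - 2 * Real.sin (x / 2) ^ 2 := by
    rw [Real.sin_sq, ← mul_div_cancel₀ x two_ne_zero, Real.cos_two_mul]
    ring_nf
  rcases eq_or_ne x 0 with rfl | hx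
  · simp
  · rw [half_angle, Real.sinc_of_ne_zero (div_ne_zero hx two_ne_zero)]
    field_simp

theorem tendsto_stepCharFun_pow (u : ℝ) :
    Tendsto (fun n : ℕ => stepCharFun (u / √n) ^ n) atTop (𝓝 (Real.exp (-(1 / 3) * u ^ 2))) := by
  have tendsto_sinc : Tendsto (fun n : ℕ => Real.sinc (u / √n / 2)) atTop (𝓝 1) := by
    simpa [Function.comp_def] using
      (Real.continuous_sinc.tendsto _).comp ((tendsto_div_sqrt_natCast u).div_const 2)
  have tendsto_exponent : Tendsto (fun n : ℕ => (n : ℝ) * (stepCharFun (u / √n) - 1)) atTop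
      (𝓝 (-(1 / 3) * u ^ 2)) := by
    have h_lim := (tendsto_sinc.pow 2).const_mul (-(1 / 3) * u ^ 2)
    rw [one_pow, mul_one] at h_lim
    refine h_lim.congr' ?_
    filter_upwards [eventually_gt_atTop 0] with n hn
    rw [stepCharFun, cos_eq_one_sub_sq_mul_sinc_sq, div_pow u, Real.sq_sqrt n.cast_nonneg]
    field_simp
    ring
  simpa using Real.tendsto_one_add_pow_exp_of_tendsto tendsto_exponent

/-- The integrand of `integral_stepCharFun_pow_mul_cos` after the substitution `θ = u / √n`, as a
function on the whole line. -/
noncomputable def walkKernel (j : ℤ) (n : ℕ) (u : ℝ) : ℝ :=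
  (Set.Ioc (-Real.pi) Real.pi).indicator (fun θ => stepCharFun θ ^ n * Real.cos (j * θ)) (u / √n)

lemma measurable_walkKernel (j : ℤ) (n : ℕ) : Measurable (walkKernel j n) :=
  (((continuous_stepCharFun.pow n).mul (by fun_prop)).measurable.indicator
    measurableSet_Ioc).comp (measurable_id.div_const _)

lemma integral_walkKernel (j : ℤ) (n : ℕ) :
    ∫ u, walkKernel j n u = 2 * Real.pi * (walkCount n j * √n / 3 ^ n) := by
  simp only [walkKernel]
  rw [Measure.integral_comp_div (Set.indicator (Set.Ioc (-Real.pi) Real.pi) _) (√n),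
    integral_indicator measurableSet_Ioc,
    ← intervalIntegral.integral_of_le (neg_le_self Real.pi_pos.le),
    integral_stepCharFun_pow_mul_cos, abs_of_nonneg (Real.sqrt_nonneg _), smul_eq_mul]
  ring

lemma norm_walkKernel_le (j : ℤ) {n : ℕ} (hn : 0 < n) (u : ℝ) :
    ‖walkKernel j n u‖ ≤ Real.exp (-(2 / (3 * Real.pi ^ 2)) * u ^ 2) := by
  rw [walkKernel]
  by_cases hu : u / √n ∈ Set.Ioc (-Real.pi) Real.pi
  · rw [Set.indicator_of_mem hu, Real.norm_eq_abs, abs_mul, abs_pow]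
    calc |stepCharFun (u / √n)| ^ n * |Real.cos (j * (u / √n))|
        ≤ Real.exp (-(2 / (3 * Real.pi ^ 2)) * (u / √n) ^ 2) ^ n * 1 := by
          gcongr
          · exact abs_stepCharFun_le (abs_le.2 ⟨hu.1.le, hu.2⟩)
          · exact Real.abs_cos_le_one _
      _ = Real.exp (-(2 / (3 * Real.pi ^ 2)) * u ^ 2) := by
          rw [mul_one, ← Real.exp_nat_mul, div_pow u, Real.sq_sqrt n.cast_nonneg]
          congr 1
          field_simp
  · rw [Set.indicator_of_notMem hu, norm_zero]
    positivity

lemma tendsto_walkKernel (j : ℤ) (u : ℝ) :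
    Tendsto (fun n => walkKernel j n u) atTop (𝓝 (Real.exp (-(1 / 3) * u ^ 2))) := by
  have tendsto_zero := tendsto_div_sqrt_natCast u
  have eventually_mem : ∀ᶠ n : ℕ in atTop, u / √n ∈ Set.Ioc (-Real.pi) Real.pi :=
    tendsto_zero.eventually (Ioc_mem_nhds (neg_lt_zero.2 Real.pi_pos) Real.pi_pos)
  have tendsto_cos : Tendsto (fun n : ℕ => Real.cos (j * (u / √n))) atTop (𝓝 1) := by
    simpa [Function.comp_def] using
      (Real.continuous_cos.tendsto _).comp (tendsto_zero.const_mul (j : ℝ))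
  rw [← mul_one (Real.exp _)]
  refine ((tendsto_stepCharFun_pow u).mul tendsto_cos).congr' ?_
  filter_upwards [eventually_mem] with n hn
  rw [walkKernel, Set.indicator_of_mem hn]

theorem tendsto_walkCount (j : ℤ) :
    Tendsto (fun n : ℕ => (walkCount n j : ℝ) * √n / 3 ^ n) atTop
      (𝓝 (√3 / (2 * √Real.pi))) := by
  have tendsto_integral := tendsto_integral_filter_of_dominated_convergence
    (μ := volume) (F := walkKernel j) (fun u => Real.exp (-(2 / (3 * Real.pi ^ 2)) * u ^ 2))
    (Eventually.of_forall fun n => (measurable_walkKernel j n).aestronglyMeasurable)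
    ((eventually_gt_atTop 0).mono fun n hn => Eventually.of_forall (norm_walkKernel_le j hn))
    (integrable_exp_neg_mul_sq (by positivity))
    (Eventually.of_forall (tendsto_walkKernel j))
  simp only [integral_gaussian, integral_walkKernel] at tendsto_integral
  have constant : (2 * Real.pi)⁻¹ * √(Real.pi / (1 / 3)) = √3 / (2 * √Real.pi) := by
    rw [show Real.pi / (1 / 3) = 3 * Real.pi by ring, Real.sqrt_mul zero_le_three]
    field_simp
    rw [Real.sq_sqrt Real.pi_pos.le]
  rw [← constant]
  refine (tendsto_integral.const_mul (2 * Real.pi)⁻¹).congr fun n => ?_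
  rw [inv_mul_cancel_left₀ (by positivity)]

lemma tendsto_succ_mul_sqrt_div_pow_iff {f : ℕ → ℝ} {a r : ℝ} (hr : r ≠ 0) :
    Tendsto (fun n : ℕ => f (n + 1) * √n / r ^ n) atTop (𝓝 (a * r)) ↔
      Tendsto (fun n : ℕ => f n * √n / r ^ n) atTop (𝓝 a) := by
  have tendsto_ratio : Tendsto (fun n : ℕ => √((n : ℝ) / (n + 1)) * r) atTop (𝓝 r) := by
    simpa using (tendsto_natCast_div_add_atTop (1 : ℝ)).sqrt.mul_const r
  rw [← tendsto_add_atTop_iff_nat (f := fun n : ℕ => f n * √n / r ^ n) 1]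
  refine Iff.trans (tendsto_congr fun n => ?_) (tendsto_mul_iff_of_ne_zero tendsto_ratio hr)
  rw [Real.sqrt_div n.cast_nonneg, pow_succ, Nat.cast_add_one]
  field_simp

theorem tendsto_hasseEdges :
    Tendsto (fun n : ℕ => (hasseEdges (MotzkinPath n) : ℝ) * √n / 3 ^ n) atTop
      (𝓝 (4 / 3 * (√3 / (2 * √Real.pi)))) := by
  have h_walk := tendsto_walkCount 2
  have h_walk_succ := (tendsto_succ_mul_sqrt_div_pow_iff three_ne_zero).2 h_walk
  rw [← tendsto_succ_mul_sqrt_div_pow_iff three_ne_zero]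
  convert h_walk_succ.add h_walk using 2 with n
  · have edges : (hasseEdges (MotzkinPath (n + 1)) : ℝ) = walkCount (n + 1) 2 + walkCount n 2 := by
      exact_mod_cast hasseEdges_succ n
    rw [edges]
    ring
  · ring

theorem tendsto_motzkinNumber :
    Tendsto (fun n : ℕ => (motzkinNumber n : ℝ) * n * √n / 3 ^ n) atTop
      (𝓝 (√3 / (2 * √Real.pi) * 3)) := by
  have h_walk := (tendsto_succ_mul_sqrt_div_pow_iff three_ne_zero).2 (tendsto_walkCount 1)
  have h_lim := h_walk.mul (tendsto_natCast_div_add_atTop (1 : ℝ))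
  rw [mul_one] at h_lim
  refine h_lim.congr fun n => ?_
  have motzkin : (n + 1) * (motzkinNumber n : ℝ) = walkCount (n + 1) 1 := by
    exact_mod_cast motzkinNumber_eq_ballot n ▸ succ_mul_ballot_zero n
  rw [← motzkin]
  field_simp

theorem hasseEdges_isEquivalent : (fun n : ℕ => (hasseEdges (MotzkinPath n) : ℝ)) ~[atTop]
    fun n : ℕ => 2 * (3 : ℝ) ^ n / √(3 * (n : ℝ) * Real.pi) := by
  refine isEquivalent_of_tendsto_one ?_
  have h_lim := tendsto_hasseEdges.mul_const (√3 * √Real.pi / 2)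
  have constant : 4 / 3 * (√3 / (2 * √Real.pi)) * (√3 * √Real.pi / 2) = 1 := by
    field_simp
    rw [Real.sq_sqrt zero_le_three]
    norm_num
  rw [constant] at h_lim
  refine h_lim.congr fun n => ?_
  rw [Pi.div_apply, Real.sqrt_mul (by positivity), Real.sqrt_mul zero_le_three,
    div_div_eq_mul_div]
  field_simp

theorem hasseIndex_isEquivalent : (fun n : ℕ => hasseIndex (MotzkinPath n)) ~[atTop]
    fun n : ℕ => (4 / 9 : ℝ) * (n : ℝ) := by
  refine isEquivalent_of_tendsto_one ?_
  have h_lim := (tendsto_hasseEdges.div tendsto_motzkinNumber (by positivity)).mul_const (9 / 4)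
  have constant : 4 / 3 * (√3 / (2 * √Real.pi)) / (√3 / (2 * √Real.pi) * 3) * (9 / 4) = 1 := by
    field_simp
    norm_num
  rw [constant] at h_lim
  refine h_lim.congr' ?_
  filter_upwards [eventually_gt_atTop 0] with n hn
  rw [Pi.div_apply, Pi.div_apply, div_div_div_cancel_right₀ (by positivity),
    mul_div_mul_right _ _ (by positivity), hasseIndex, ← motzkinNumber]
  ring

theorem asymptoticallyQuasiBoolean_motzkinPath : AsymptoticallyQuasiBoolean MotzkinPath := by
  refine ⟨1 / 18, by norm_num, by norm_num, Or.inr ?_⟩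
  rw [show (1 / 2 - 1 / 18 : ℝ) = 4 / 9 by norm_num]
  exact hasseIndex_isEquivalent

end Asymptotics

/-- In the first conjunct `S` is the formal power series `√(1 - 2x - 3x²)`, and the quotient is
taken in the field of formal Laurent series. -/
theorem mainTheorem3 :
    (∃ S : ℚ⟦X⟧, PowerSeries.constantCoeff S = 1 ∧
      S ^ 2 = 1 - 2 * PowerSeries.X - 3 * PowerSeries.X ^ 2 ∧
      (edgeSeries MotzkinPath : ℚ⸨X⸩) =
        (((1 + PowerSeries.X) * (1 - 2 * PowerSeries.X - PowerSeries.X ^ 2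
            - (1 - PowerSeries.X) * S) : ℚ⟦X⟧) : ℚ⸨X⸩) /
          ((2 * PowerSeries.X ^ 2 * S : ℚ⟦X⟧) : ℚ⸨X⸩)) ∧
    edgeSeries MotzkinPath =
      (1 + PowerSeries.X) * (centralTrinomialSeries - motzkinSeries) ∧
    (∀ n : ℕ, 1 ≤ n →
      (hasseEdges (MotzkinPath n) : ℤ) =
        (trinomialCoeff n n : ℤ) - (motzkinNumber n : ℤ)
          + (trinomialCoeff (n - 1) (n - 1) : ℤ) - (motzkinNumber (n - 1) : ℤ)) ∧
    (∀ n : ℕ, 3 ≤ n →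
      hasseEdges (MotzkinPath n) =
        trinomialCoeff n (n - 2) + trinomialCoeff (n - 1) (n - 3)) ∧
    (∀ n : ℕ, 1 ≤ n →
      (hasseEdges (MotzkinPath n) : ℚ) =
        (2 / (n : ℚ)) * ∑ k ∈ Finset.range (n / 2 + 1),
          (n.choose k : ℚ) * ((n - k).choose k : ℚ)
            * (((k : ℚ) * ((n : ℚ) - (k : ℚ))) / ((k : ℚ) + 1))) ∧
    ((fun n : ℕ => (hasseEdges (MotzkinPath n) : ℝ)) ~[atTop]
      fun n : ℕ => 2 * (3 : ℝ) ^ n / Real.sqrt (3 * (n : ℝ) * Real.pi)) ∧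
    ((fun n : ℕ => hasseIndex (MotzkinPath n)) ~[atTop] fun n : ℕ => (4 / 9 : ℝ) * (n : ℝ)) ∧
    AsymptoticallyQuasiBoolean MotzkinPath := by
  refine ⟨⟨sqrtSeries, constantCoeff_sqrtSeries, sqrtSeries_sq, edgeSeries_motzkinPath_eq_div⟩,
    edgeSeries_motzkinPath, fun n hn => ?_, fun n hn => ?_, fun _ => hasseEdges_eq_sum_choose,
    hasseEdges_isEquivalent, hasseIndex_isEquivalent, asymptoticallyQuasiBoolean_motzkinPath⟩
  · obtain ⟨n, rfl⟩ := Nat.exists_eq_add_of_le' hn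
    rw [hasseEdges_succ_eq_trinomialCoeff_sub, add_tsub_cancel_right]
    ring
  · obtain ⟨n, rfl⟩ := Nat.exists_eq_add_of_le' hn
    exact hasseEdges_add_three n
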